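/- Let $d\ge 0$, let $\mu=N(0,I)$ be the standard Gaussian measure on $\mathbb R^d$, let $f:\mathbb R\to\mathbb R$ be measurable, and let $x_i,x_j\in\mathbb R^d$ be such that the functions $\phi_{x_i}(w)=f(\langle x_i,w\rangle)$ and $\phi_{x_j}(w)=f(\langle x_j,w\rangle)$ are $\mu$-integrable. Let $C(w_1,w_2)=c(w_1-w_2)$ be a real shift-invariant covariance function on $\mathbb R^d$ with Bochner measure $\rho$, that is, $\rho$ is a finite Borel measure on $\mathbb R^d$ with $c(\delta)=\int e^{\mathrm i\langle w,\delta\rangle}\,d\rho(w)$ for all $\delta\in\mathbb R^d$ (a probability measure exactly when $c(0)=1$; below, $E_w$ denotes $\int\cdot\,d\rho(w)$). Let $g(t)=\sqrt2\cos t$, let $b$ be uniformly distributed on $[0,2\pi]$ and independent of $w\sim\rho$, and, given $(w,b)$, let $\hat z=(\hat z_1,\dots,\hat z_6)\sim N(0,\hat\Sigma)$, where $$\hat\Sigma=\begin{pmatrix}\|x_i\|^2&\langle x_i,w\rangle&\langle x_i,x_j\rangle\\ \langle x_i,w\rangle&\|w\|^2&\langle w,x_j\rangle\\ \langle x_i,x_j\rangle&\langle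 x_j,w\rangle&\|x_j\|^2\end{pmatrix}\otimes\begin{pmatrix}1&0\\0&1\end{pmatrix}.$$ Then $\hat\Sigma$ is positive semidefinite for every $w$, and the covariance matrix $$\Sigma=E_{w_1,w_2\sim\mu\ \text{independent}}\begin{pmatrix}\phi_{x_i}(w_1)\,C(w_1,w_2)\,\phi_{x_i}(w_2)&\phi_{x_i}(w_1)\,C(w_1,w_2)\,\phi_{x_j}(w_2)\\ \phi_{x_i}(w_1)\,C(w_1,w_2)\,\phi_{x_j}(w_2)&\phi_{x_j}(w_1)\,C(w_1,w_2)\,\phi_{x_j}(w_2)\end{pmatrix}$$ of the stochastic kernel is positive semidefinite and satisfies $$\Sigma=E_{w,b,\hat z}\begin{pmatrix}f(\hat z_1)f(\hat z_2)\,g(\hat z_3+b)g(\hat z_4+b)&f(\hat z_1)f(\hat z_6)\,g(\hat z_3+b)g(\hat z_4+b)\\ f(\hat z_1)f(\hat z_6)\,g(\hat z_3+b)g(\hat z_4+b)&f(\hat z_5)f(\hat z_6)\,g(\hat z_3+b)g(\hat z_4+b)\end{pmatrix},$$ where all the expectations converge absolutely. Moreover, for every jointly measurable Gaussian process $u\sim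 GP(C)$ (with zero mean function and covariance function $C$) on a probability space, the integrals $\langle\phi_{x},u\rangle=\int\phi_x(w)u(w)\,d\mu(w)$, $x\in\{x_i,x_j\}$, converge absolutely almost surely, the pair $(\langle\phi_{x_i},u\rangle,\langle\phi_{x_j},u\rangle)$ has the law $N(0,\Sigma)$, and the stochastic kernel for deep infinite neural networks satisfies $$k^{(2)}_f(x_i,x_j):=E_{u\sim GP(C)}\big[f(\langle\phi_{x_i},u\rangle)f(\langle\phi_{x_j},u\rangle)\big]=E_{(z_1,z_2)\sim N(0,\Sigma)}\big[f(z_1)f(z_2)\big],$$ where one of the two expectations exists if and only if the other one does. -/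

import Mathlib

open MeasureTheory ProbabilityTheory
open scoped Kronecker

universe u

noncomputable section

namespace DeepInfinite

/-- The standard Gaussian distribution `N(0, I)` on `ℝ^d`. -/
abbrev gauss (d : ℕ) : Measure (EuclideanSpace ℝ (Fin d)) :=
  stdGaussian (EuclideanSpace ℝ (Fin d))

/-- The first layer response `φ_x(w) = f(⟨x, w⟩)`. -/
def feature {d : ℕ} (f : ℝ → ℝ) (x w : EuclideanSpace ℝ (Fin d)) : ℝ :=
  f (inner ℝ x w)

/-- The input `⟨φ_x, v⟩ = ∫ φ_x(w) v(w) dμ(w)`, `μ = N(0, I)`, of the second layer neuron `v`. -/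
def response {d : ℕ} (f : ℝ → ℝ) (x : EuclideanSpace ℝ (Fin d))
    (v : EuclideanSpace ℝ (Fin d) → ℝ) : ℝ :=
  ∫ w, feature f x w * v w ∂(gauss d)

/-- `U` is a (jointly measurable) Gaussian process on `(Ω, P)` with zero mean function and
covariance function `C`, that is `U ∼ GP(C)`. -/
structure IsGP {d : ℕ} {Ω : Type u} [MeasurableSpace Ω]
    (C : EuclideanSpace ℝ (Fin d) → EuclideanSpace ℝ (Fin d) → ℝ)
    (U : EuclideanSpace ℝ (Fin d) → Ω → ℝ) (P : Measure Ω) : Prop where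
  measurable : Measurable fun p : EuclideanSpace ℝ (Fin d) × Ω => U p.1 p.2
  gaussian : IsGaussianProcess U P
  mean_zero : ∀ w, ∫ ω, U w ω ∂P = 0
  covariance : ∀ w₁ w₂, ∫ ω, U w₁ ω * U w₂ ω ∂P = C w₁ w₂

/-- The stochastic kernel `k⁽²⁾_f(x, y) = E_U[f(⟨φ_x, U⟩) f(⟨φ_y, U⟩)]`. -/
def stochasticKernel {d : ℕ} {Ω : Type u} [MeasurableSpace Ω] (f : ℝ → ℝ)
    (U : EuclideanSpace ℝ (Fin d) → Ω → ℝ) (P : Measure Ω)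
    (x y : EuclideanSpace ℝ (Fin d)) : ℝ :=
  ∫ ω, f (response f x fun w => U w ω) * f (response f y fun w => U w ω) ∂P

/-- The matrix whose expectation over independent `w₁, w₂ ∼ N(0, I)` is the covariance matrix of
the stochastic kernel. -/
def covIntegrand {d : ℕ} (C : EuclideanSpace ℝ (Fin d) → EuclideanSpace ℝ (Fin d) → ℝ)
    (f : ℝ → ℝ) (x y w₁ w₂ : EuclideanSpace ℝ (Fin d)) : Matrix (Fin 2) (Fin 2) ℝ :=
  !![feature f x w₁ * C w₁ w₂ * feature f x w₂, feature f x w₁ * C w₁ w₂ * feature f y w₂;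
     feature f x w₁ * C w₁ w₂ * feature f y w₂, feature f y w₁ * C w₁ w₂ * feature f y w₂]

/-- The covariance matrix `Σ` of the stochastic kernel. -/
def kernelCov {d : ℕ} (C : EuclideanSpace ℝ (Fin d) → EuclideanSpace ℝ (Fin d) → ℝ)
    (f : ℝ → ℝ) (x y : EuclideanSpace ℝ (Fin d)) : Matrix (Fin 2) (Fin 2) ℝ :=
  Matrix.of fun r s => ∫ p, covIntegrand C f x y p.1 p.2 r s ∂((gauss d).prod (gauss d))

/-- `ρ` is the Bochner measure of `c`: a finite measure whose Fourier transform is `c`,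
`c(δ) = ∫ exp(i ⟨w, δ⟩) dρ(w)`. -/
def IsBochnerMeasure {d : ℕ} (ρ : Measure (EuclideanSpace ℝ (Fin d)))
    (c : EuclideanSpace ℝ (Fin d) → ℝ) : Prop :=
  IsFiniteMeasure ρ ∧ ∀ δ, charFun ρ δ = (c δ : ℂ)

/-- `g(t) = √2 cos t`. -/
def g (t : ℝ) : ℝ := √2 * Real.cos t

/-- The uniform distribution on `[0, 2π]`. -/
def unif : Measure ℝ := ProbabilityTheory.cond volume (Set.Icc 0 (2 * Real.pi))

/-- The `6 × 6` covariance matrix: the Gram matrix of `(x, w, y)` tensored with the `2 × 2`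
identity. -/
def latentCov {d : ℕ} (x y w : EuclideanSpace ℝ (Fin d)) : Matrix (Fin 6) (Fin 6) ℝ :=
  Matrix.reindex (finProdFinEquiv (m := 3) (n := 2)) (finProdFinEquiv (m := 3) (n := 2))
    (!![‖x‖ ^ 2, inner ℝ x w, inner ℝ x y;
        inner ℝ x w, ‖w‖ ^ 2, inner ℝ w y;
        inner ℝ x y, inner ℝ y w, ‖y‖ ^ 2] ⊗ₖ !![1, 0; 0, 1])

/-- The matrix inside the expectation over `w`, `b`, `z`; the coordinates `z 0, …, z 5` are
`ẑ₁, …, ẑ₆`. -/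
def bochnerIntegrand (f : ℝ → ℝ) (b : ℝ) (z : EuclideanSpace ℝ (Fin 6)) :
    Matrix (Fin 2) (Fin 2) ℝ :=
  !![f (z 0) * f (z 1) * g (z 2 + b) * g (z 3 + b), f (z 0) * f (z 5) * g (z 2 + b) * g (z 3 + b);
     f (z 0) * f (z 5) * g (z 2 + b) * g (z 3 + b), f (z 4) * f (z 5) * g (z 2 + b) * g (z 3 + b)]

/-- The expectation of `F (w, b) z` over `(w, b) ∼ ρ ⊗ U[0, 2π]` and, given `(w, b)`,
`z ∼ N(0, latentCov x y w)`. -/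
def latentExpectation {d : ℕ} (ρ : Measure (EuclideanSpace ℝ (Fin d)))
    (x y : EuclideanSpace ℝ (Fin d)) (F : ℝ → EuclideanSpace ℝ (Fin 6) → ℝ) : ℝ :=
  ∫ p, ∫ z, F p.2 z ∂(multivariateGaussian 0 (latentCov x y p.1)) ∂(ρ.prod unif)

/-- The expectation `latentExpectation ρ x y F` converges absolutely. -/
structure LatentIntegrable {d : ℕ} (ρ : Measure (EuclideanSpace ℝ (Fin d)))
    (x y : EuclideanSpace ℝ (Fin d)) (F : ℝ → EuclideanSpace ℝ (Fin 6) → ℝ) : Prop where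
  inner : ∀ w b, Integrable (F b) (multivariateGaussian 0 (latentCov x y w))
  outer : Integrable
    (fun p => ∫ z, F p.2 z ∂(multivariateGaussian 0 (latentCov x y p.1))) (ρ.prod unif)
  outer_abs : Integrable
    (fun p => ∫ z, |F p.2 z| ∂(multivariateGaussian 0 (latentCov x y p.1))) (ρ.prod unif)

/-- The expectation of the matrix `bochnerIntegrand` over `w`, `b`, `z`. -/
def bochnerCov {d : ℕ} (ρ : Measure (EuclideanSpace ℝ (Fin d))) (f : ℝ → ℝ)
    (x y : EuclideanSpace ℝ (Fin d)) : Matrix (Fin 2) (Fin 2) ℝ :=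
  Matrix.of fun r s => latentExpectation ρ x y fun b z => bochnerIntegrand f b z r s

end DeepInfinite

end

/-!
Conditionally on the frequency `w`, the vector `ẑ` is the image of a pair of independent standard
Gaussian weights `v₁, v₂` under the inner products with `x`, `w`, `y`: the two laws have the same
characteristic function, because the quadratic form of `latentCov` is a sum of two squared norms
(`latentCov_quadratic`, `map_latentVector`). Averaging over the phase gives
`E_b[g(α + b) g(β + b)] = cos (α - β)`, and averaging over the frequency then gives the kernel
`c(v₁ - v₂)` (`IsBochnerMeasure.integral_g_mul_g`). So `kernelCov` and `bochnerCov` are the two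
iterated integrals of `fourierPair`, which is bounded by twice an integrable product of features,
and Fubini's theorem identifies them. For fixed `w` and `b`, `fourierPair` is a product of a
function of `v₁` and a function of `v₂`; hence `bochnerCov` is a Gram matrix in `L²(ρ ⊗ U[0, 2π])`
and is positive semidefinite.

For the Gaussian process, stationarity and continuity of `c` make `w ↦ U(w)` a bounded continuous
map into `L²(P)`, so that `∫ φ(w) U(w) dμ(w)` exists as a Bochner integral in `L²(P)`
(`weightedLp`); it agrees almost surely with the pathwise integral (`weightedLp_ae`) and lies in the
closed linear span of the `U(w)`. The identity `E exp(iX) = exp(-‖X‖² / 2)` holds for the linear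
combinations of the `U(w)` and is a closed condition in `L²(P)`, hence it holds on the closed span
(`closure_span_marginalLp_subset`). Applied to the linear combinations of the two second layer
inputs, whose inner products are the entries of the covariance matrix, it gives the characteristic
function of the pair and so its law. The formula for the kernel is a change of variables.
-/

noncomputable section

namespace DeepInfinite

/-! ### The latent Gaussian vector -/

lemma latentCov_eq {d : ℕ} (x y w : EuclideanSpace ℝ (Fin d)) : latentCov x y w =
    !![‖x‖ ^ 2, 0, inner ℝ x w, 0, inner ℝ x y, 0;
       0, ‖x‖ ^ 2, 0, inner ℝ x w, 0, inner ℝ x y;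
       inner ℝ x w, 0, ‖w‖ ^ 2, 0, inner ℝ w y, 0;
       0, inner ℝ x w, 0, ‖w‖ ^ 2, 0, inner ℝ w y;
       inner ℝ x y, 0, inner ℝ y w, 0, ‖y‖ ^ 2, 0;
       0, inner ℝ x y, 0, inner ℝ y w, 0, ‖y‖ ^ 2] := by
  ext i j
  fin_cases i <;> fin_cases j <;>
    simp [latentCov, finProdFinEquiv, Fin.divNat, Fin.modNat]

/-- The Kronecker factor is the identity, so the quadratic form splits into the Gram forms of
`x, w, y` in the even and in the odd coordinates of `t`. -/
lemma latentCov_quadratic {d : ℕ} (x y w : EuclideanSpace ℝ (Fin d)) (t : Fin 6 → ℝ) :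
    dotProduct t ((latentCov x y w).mulVec t) =
      ‖t 0 • x + t 2 • w + t 4 • y‖ ^ 2 + ‖t 1 • x + t 3 • w + t 5 • y‖ ^ 2 := by
  have n : ∀ a b c : ℝ, ‖a • x + b • w + c • y‖ ^ 2 = a ^ 2 * ‖x‖ ^ 2 + b ^ 2 * ‖w‖ ^ 2
      + c ^ 2 * ‖y‖ ^ 2 + 2 * a * b * inner ℝ x w + 2 * a * c * inner ℝ x y
      + 2 * b * c * inner ℝ w y := by
    intro a b c
    simp only [norm_add_sq_real, inner_add_left, real_inner_smul_left, real_inner_smul_right,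
      norm_smul, mul_pow, Real.norm_eq_abs, sq_abs]
    ring
  rw [n, n]
  simp only [dotProduct, Matrix.mulVec, latentCov_eq, Fin.sum_univ_six, Matrix.of_apply,
    Matrix.cons_val, real_inner_comm w y]
  ring

lemma latentCov_posSemidef {d : ℕ} (x y w : EuclideanSpace ℝ (Fin d)) :
    (latentCov x y w).PosSemidef := by
  refine Matrix.PosSemidef.of_dotProduct_mulVec_nonneg ?_ fun t => ?_
  · rw [latentCov_eq]
    ext i j
    fin_cases i <;> fin_cases j <;> simp [real_inner_comm]
  · rw [star_trivial, latentCov_quadratic]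
    positivity

/-- The vector `ẑ` built from a pair of independent first layer weights `v = (v₁, v₂)`. -/
def latentVector {d : ℕ} (x y w : EuclideanSpace ℝ (Fin d))
    (v : EuclideanSpace ℝ (Fin d) × EuclideanSpace ℝ (Fin d)) : EuclideanSpace ℝ (Fin 6) :=
  !₂[inner ℝ x v.1, inner ℝ x v.2, inner ℝ w v.1, inner ℝ w v.2, inner ℝ y v.1, inner ℝ y v.2]

lemma continuous_latentVector {d : ℕ} (x y w : EuclideanSpace ℝ (Fin d)) :
    Continuous (latentVector x y w) := by
  refine (PiLp.continuous_toLp 2 _).comp (continuous_pi fun i => ?_)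
  fin_cases i <;> simp <;> fun_prop

lemma map_latentVector {d : ℕ} (x y w : EuclideanSpace ℝ (Fin d)) :
    ((gauss d).prod (gauss d)).map (latentVector x y w) =
      multivariateGaussian 0 (latentCov x y w) := by
  have hL := continuous_latentVector x y w
  have : IsProbabilityMeasure (((gauss d).prod (gauss d)).map (latentVector x y w)) :=
    Measure.isProbabilityMeasure_map hL.aemeasurable
  refine Measure.ext_of_charFun (funext fun t => ?_)
  rw [charFun_multivariateGaussian (latentCov_posSemidef x y w), latentCov_quadratic,
    charFun_apply, integral_map hL.aemeasurable (by fun_prop)]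
  have e : ∀ v : EuclideanSpace ℝ (Fin d) × EuclideanSpace ℝ (Fin d),
      Complex.exp ((inner ℝ (latentVector x y w v) t : ℝ) * Complex.I) =
      Complex.exp ((inner ℝ v.1 (t 0 • x + t 2 • w + t 4 • y) : ℝ) * Complex.I) *
      Complex.exp ((inner ℝ v.2 (t 1 • x + t 3 • w + t 5 • y) : ℝ) * Complex.I) := by
    intro v
    rw [← Complex.exp_add, ← add_mul, ← Complex.ofReal_add]
    congr 3
    rw [PiLp.inner_apply, Fin.sum_univ_six]
    simp only [latentVector, inner_add_right, real_inner_smul_right, real_inner_comm v.1,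
      real_inner_comm v.2, RCLike.inner_apply, conj_trivial, Matrix.cons_val]
    ring
  simp_rw [e]
  rw [integral_prod_mul
      (fun v => Complex.exp ((inner ℝ v (t 0 • x + t 2 • w + t 4 • y) : ℝ) * Complex.I))
      (fun v => Complex.exp ((inner ℝ v (t 1 • x + t 3 • w + t 5 • y) : ℝ) * Complex.I)),
    ← charFun_apply, ← charFun_apply, charFun_stdGaussian, charFun_stdGaussian, ← Complex.exp_add]
  congr 1
  simp
  ring

/-! ### Random Fourier features -/

lemma continuous_g : Continuous g := by unfold g; fun_prop

lemma abs_g_le (t : ℝ) : |g t| ≤ √2 := by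
  rw [g, abs_mul, abs_of_nonneg (Real.sqrt_nonneg 2)]
  exact mul_le_of_le_one_right (Real.sqrt_nonneg 2) (Real.abs_cos_le_one t)

lemma isProbabilityMeasure_unif : IsProbabilityMeasure unif := by
  refine cond_isProbabilityMeasure_of_finite ?_ ?_
  · simp [Real.volume_Icc, Real.pi_pos]
  · rw [Real.volume_Icc]
    exact ENNReal.ofReal_ne_top

lemma integral_g_mul_g (α β : ℝ) : ∫ b, g (α + b) * g (β + b) ∂unif = Real.cos (α - β) := by
  have e : ∀ b, g (α + b) * g (β + b) = Real.cos (α - β) + Real.cos ((α + β) + 2 * b) := by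
    intro b
    have h2 : √2 * √2 = 2 := Real.mul_self_sqrt (by norm_num)
    have h3 : α - β = (α + b) - (β + b) := by ring
    have h4 : α + β + 2 * b = (α + b) + (β + b) := by ring
    rw [h3, h4, Real.cos_sub, Real.cos_add (α + b), g, g]
    linear_combination Real.cos (α + b) * Real.cos (β + b) * h2
  simp_rw [e]
  have h0 : (0 : ℝ) ≤ 2 * Real.pi := by positivity
  -- The phase `2b` runs over two full periods of the cosine.
  have hper : ∫ b in (0 : ℝ)..(2 * Real.pi), Real.cos ((α + β) + 2 * b) = 0 := by
    rw [intervalIntegral.integral_comp_add_mul _ (by norm_num), integral_cos,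
      show α + β + 2 * (2 * Real.pi) = α + β + 2 * 0 + 2 * Real.pi + 2 * Real.pi by ring,
      Real.sin_add_two_pi, Real.sin_add_two_pi]
    simp
  rw [unif, ProbabilityTheory.cond, integral_smul_measure, integral_Icc_eq_integral_Ioc,
    ← intervalIntegral.integral_of_le h0, intervalIntegral.integral_add
      (by simp) ((by fun_prop : Continuous _).intervalIntegrable _ _), hper]
  simp only [Real.volume_Icc, sub_zero, intervalIntegral.integral_const, smul_eq_mul, add_zero,
    ENNReal.toReal_inv, ENNReal.toReal_ofReal h0]
  field_simp

section

variable {d : ℕ} {ρ : Measure (EuclideanSpace ℝ (Fin d))} {c : EuclideanSpace ℝ (Fin d) → ℝ}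

lemma IsBochnerMeasure.eq_integral_cos (hρ : IsBochnerMeasure ρ c) (δ : EuclideanSpace ℝ (Fin d)) :
    c δ = ∫ w, Real.cos (inner ℝ w δ) ∂ρ := by
  have := hρ.1
  have h := congrArg Complex.re (hρ.2 δ)
  rw [charFun_apply, Complex.ofReal_re, ← RCLike.re_eq_complex_re, ← integral_re] at h
  · rw [← h]
    simp [Complex.exp_ofReal_mul_I_re]
  · exact Integrable.of_bound (C := 1) (by fun_prop)
      (.of_forall fun w => by rw [Complex.norm_exp_ofReal_mul_I])

lemma IsBochnerMeasure.continuous (hρ : IsBochnerMeasure ρ c) : Continuous c := by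
  have := hρ.1
  have h : Continuous fun δ => (charFun ρ δ).re := Complex.continuous_re.comp continuous_charFun
  simpa [hρ.2] using h

/-- Random Fourier features: the kernel `c (v₁ - v₂)` is the mean product of two cosines with a
common random frequency and phase. -/
lemma IsBochnerMeasure.integral_g_mul_g (hρ : IsBochnerMeasure ρ c)
    (v₁ v₂ : EuclideanSpace ℝ (Fin d)) :
    ∫ p, g (inner ℝ p.1 v₁ + p.2) * g (inner ℝ p.1 v₂ + p.2) ∂(ρ.prod unif) = c (v₁ - v₂) := by
  have := hρ.1
  have := isProbabilityMeasure_unif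
  rw [integral_prod, hρ.eq_integral_cos]
  · simp_rw [DeepInfinite.integral_g_mul_g, inner_sub_right]
  · have hg := continuous_g
    refine Integrable.of_bound (C := √2 * √2) (by fun_prop) (.of_forall fun p => ?_)
    rw [norm_mul]
    exact mul_le_mul (abs_g_le _) (abs_g_le _) (norm_nonneg _) (Real.sqrt_nonneg 2)

/-- The first layer response at `p`, weighted by a cosine of frequency `w` and phase `b` and
averaged over the first layer weights. -/
def fourierCoeff (f : ℝ → ℝ) (p : EuclideanSpace ℝ (Fin d))
    (q : EuclideanSpace ℝ (Fin d) × ℝ) : ℝ :=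
  ∫ v, feature f p v * g (inner ℝ q.1 v + q.2) ∂(gauss d)

/-- The integrand over frequency, phase and two independent first layer weights that has
`kernelCov` and `bochnerCov` as its two iterated integrals. -/
def fourierPair (f : ℝ → ℝ) (p₁ p₂ : EuclideanSpace ℝ (Fin d))
    (a : (EuclideanSpace ℝ (Fin d) × ℝ) × (EuclideanSpace ℝ (Fin d) × EuclideanSpace ℝ (Fin d))) :
    ℝ :=
  (feature f p₁ a.2.1 * g (inner ℝ a.1.1 a.2.1 + a.1.2)) *
    (feature f p₂ a.2.2 * g (inner ℝ a.1.1 a.2.2 + a.1.2))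

variable {f : ℝ → ℝ} {p₁ p₂ : EuclideanSpace ℝ (Fin d)}

lemma measurable_feature (hf : Measurable f) (p : EuclideanSpace ℝ (Fin d)) :
    Measurable (feature f p) :=
  hf.comp (by fun_prop)

lemma measurable_fourierPair (hf : Measurable f) : Measurable (fourierPair f p₁ p₂) := by
  have h₁ := measurable_feature hf p₁
  have h₂ := measurable_feature hf p₂
  have hg := continuous_g.measurable
  unfold fourierPair
  fun_prop

lemma norm_fourierPair_le (a) :
    ‖fourierPair f p₁ p₂ a‖ ≤ ‖feature f p₁ a.2.1 * feature f p₂ a.2.2‖ * 2 := by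
  rw [fourierPair, norm_mul, norm_mul, norm_mul, norm_mul]
  have h2 : √2 * √2 = 2 := Real.mul_self_sqrt (by norm_num)
  calc _ = (‖feature f p₁ a.2.1‖ * ‖feature f p₂ a.2.2‖) *
        (|g (inner ℝ a.1.1 a.2.1 + a.1.2)| * |g (inner ℝ a.1.1 a.2.2 + a.1.2)|) := by
          simp only [Real.norm_eq_abs]
          ring
    _ ≤ _ := by
      refine mul_le_mul_of_nonneg_left ?_ (by positivity)
      rw [← h2]
      exact mul_le_mul (abs_g_le _) (abs_g_le _) (abs_nonneg _) (Real.sqrt_nonneg 2)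

lemma integrable_fourierPair_right (hf : Measurable f) (h₁ : Integrable (feature f p₁) (gauss d))
    (h₂ : Integrable (feature f p₂) (gauss d)) (q : EuclideanSpace ℝ (Fin d) × ℝ) :
    Integrable (fun v => fourierPair f p₁ p₂ (q, v)) ((gauss d).prod (gauss d)) :=
  ((h₁.mul_prod h₂).norm.mul_const 2).mono'
    ((measurable_fourierPair hf).comp measurable_prodMk_left).aestronglyMeasurable
    (.of_forall fun v => norm_fourierPair_le (q, v))

lemma integrable_fourierPair [IsFiniteMeasure ρ] (hf : Measurable f)
    (h₁ : Integrable (feature f p₁) (gauss d)) (h₂ : Integrable (feature f p₂) (gauss d)) :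
    Integrable (fourierPair f p₁ p₂) ((ρ.prod unif).prod ((gauss d).prod (gauss d))) := by
  have := isProbabilityMeasure_unif
  exact (((h₁.mul_prod h₂).norm.mul_const 2).comp_snd (ρ.prod unif)).mono'
    (measurable_fourierPair hf).aestronglyMeasurable (.of_forall norm_fourierPair_le)

lemma integral_fourierPair_right (q : EuclideanSpace ℝ (Fin d) × ℝ) :
    ∫ v, fourierPair f p₁ p₂ (q, v) ∂((gauss d).prod (gauss d)) =
      fourierCoeff f p₁ q * fourierCoeff f p₂ q :=
  integral_prod_mul (fun v => feature f p₁ v * g (inner ℝ q.1 v + q.2))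
    (fun v => feature f p₂ v * g (inner ℝ q.1 v + q.2))

/-- Integrating out frequency and phase leaves the integrand of `kernelCov`. -/
lemma integral_fourierPair_left (hρ : IsBochnerMeasure ρ c)
    (v : EuclideanSpace ℝ (Fin d) × EuclideanSpace ℝ (Fin d)) :
    ∫ q, fourierPair f p₁ p₂ (q, v) ∂(ρ.prod unif) =
      feature f p₁ v.1 * c (v.1 - v.2) * feature f p₂ v.2 := by
  rw [← hρ.integral_g_mul_g, mul_right_comm, ← integral_const_mul]
  refine integral_congr_ae (.of_forall fun q => ?_)
  simp only [fourierPair]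
  ring

lemma integrable_fourierCoeff_mul [IsFiniteMeasure ρ] (hf : Measurable f)
    (h₁ : Integrable (feature f p₁) (gauss d)) (h₂ : Integrable (feature f p₂) (gauss d)) :
    Integrable (fun q => fourierCoeff f p₁ q * fourierCoeff f p₂ q) (ρ.prod unif) := by
  have := isProbabilityMeasure_unif
  simpa only [integral_fourierPair_right] using
    (integrable_fourierPair (ρ := ρ) hf h₁ h₂).integral_prod_left

lemma integrable_feature_mul_cov (hρ : IsBochnerMeasure ρ c) (hf : Measurable f)
    (h₁ : Integrable (feature f p₁) (gauss d)) (h₂ : Integrable (feature f p₂) (gauss d)) :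
    Integrable (fun v : EuclideanSpace ℝ (Fin d) × EuclideanSpace ℝ (Fin d) =>
      feature f p₁ v.1 * c (v.1 - v.2) * feature f p₂ v.2) ((gauss d).prod (gauss d)) := by
  have := hρ.1
  have := isProbabilityMeasure_unif
  simpa only [integral_fourierPair_left hρ] using
    (integrable_fourierPair (ρ := ρ) hf h₁ h₂).integral_prod_right

lemma integral_feature_mul_cov (hρ : IsBochnerMeasure ρ c) (hf : Measurable f)
    (h₁ : Integrable (feature f p₁) (gauss d)) (h₂ : Integrable (feature f p₂) (gauss d)) :
    ∫ v, feature f p₁ v.1 * c (v.1 - v.2) * feature f p₂ v.2 ∂((gauss d).prod (gauss d)) =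
      ∫ q, fourierCoeff f p₁ q * fourierCoeff f p₂ q ∂(ρ.prod unif) := by
  have := hρ.1
  have := isProbabilityMeasure_unif
  simp_rw [← integral_fourierPair_left hρ, ← integral_fourierPair_right]
  exact (integral_integral_swap (f := fun q v => fourierPair f p₁ p₂ (q, v))
    (integrable_fourierPair hf h₁ h₂)).symm

variable {x y : EuclideanSpace ℝ (Fin d)}

/-- The entry `(1, 0)` repeats the entry `(0, 1)`, so the first factor belongs to `y` only in the
entry `(1, 1)` and the second factor belongs to `x` only in the entry `(0, 0)`. -/
lemma covIntegrand_apply (C : EuclideanSpace ℝ (Fin d) → EuclideanSpace ℝ (Fin d) → ℝ)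
    (v₁ v₂ : EuclideanSpace ℝ (Fin d)) (r s : Fin 2) :
    covIntegrand C f x y v₁ v₂ r s = feature f (!![x, x; x, y] r s) v₁ * C v₁ v₂ *
      feature f (!![x, y; y, y] r s) v₂ := by
  fin_cases r <;> fin_cases s <;> simp [covIntegrand]

lemma bochnerIntegrand_latentVector (w : EuclideanSpace ℝ (Fin d)) (b : ℝ)
    (v : EuclideanSpace ℝ (Fin d) × EuclideanSpace ℝ (Fin d)) (r s : Fin 2) :
    bochnerIntegrand f b (latentVector x y w v) r s =
      fourierPair f (!![x, x; x, y] r s) (!![x, y; y, y] r s) ((w, b), v) := by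
  fin_cases r <;> fin_cases s <;>
    simp [bochnerIntegrand, latentVector, fourierPair, feature] <;> ring

lemma measurable_bochnerIntegrand (hf : Measurable f) (b : ℝ) (r s : Fin 2) :
    Measurable fun z => bochnerIntegrand f b z r s := by
  have hg := continuous_g.measurable
  fin_cases r <;> fin_cases s <;> simp [bochnerIntegrand] <;> fun_prop

lemma integrable_feature_entries (hx : Integrable (feature f x) (gauss d))
    (hy : Integrable (feature f y) (gauss d)) (r s : Fin 2) :
    Integrable (feature f (!![x, x; x, y] r s)) (gauss d) ∧
      Integrable (feature f (!![x, y; y, y] r s)) (gauss d) := by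
  fin_cases r <;> fin_cases s <;> simp [hx, hy]

/-- The Gaussian expectation over `ẑ` as an integral over two independent first layer weights. -/
lemma integral_bochnerIntegrand (hf : Measurable f) (w : EuclideanSpace ℝ (Fin d)) (b : ℝ)
    (r s : Fin 2) :
    ∫ z, bochnerIntegrand f b z r s ∂(multivariateGaussian 0 (latentCov x y w)) =
      ∫ v, fourierPair f (!![x, x; x, y] r s) (!![x, y; y, y] r s) ((w, b), v)
        ∂((gauss d).prod (gauss d)) := by
  rw [← map_latentVector, integral_map (continuous_latentVector x y w).aemeasurable
    (measurable_bochnerIntegrand hf b r s).aestronglyMeasurable]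
  simp_rw [bochnerIntegrand_latentVector]

lemma latentIntegrable_bochnerIntegrand [IsFiniteMeasure ρ] (hf : Measurable f)
    (hx : Integrable (feature f x) (gauss d)) (hy : Integrable (feature f y) (gauss d))
    (r s : Fin 2) : LatentIntegrable ρ x y fun b z => bochnerIntegrand f b z r s := by
  have := isProbabilityMeasure_unif
  obtain ⟨h₁, h₂⟩ := integrable_feature_entries hx hy r s
  refine ⟨fun w b => ?_, ?_, ?_⟩
  · rw [← map_latentVector, integrable_map_measure
      (measurable_bochnerIntegrand hf b r s).aestronglyMeasurable
      (continuous_latentVector x y w).aemeasurable]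
    simpa only [Function.comp_def, bochnerIntegrand_latentVector] using
      integrable_fourierPair_right hf h₁ h₂ (w, b)
  · simp_rw [integral_bochnerIntegrand hf]
    exact (integrable_fourierPair (ρ := ρ) hf h₁ h₂).integral_prod_left
  · refine (integrable_fourierPair (ρ := ρ) hf h₁ h₂).norm.integral_prod_left.congr
      (.of_forall fun q => ?_)
    dsimp only
    rw [← map_latentVector, integral_map (continuous_latentVector x y q.1).aemeasurable
      (measurable_bochnerIntegrand hf q.2 r s).abs.aestronglyMeasurable]
    simp_rw [bochnerIntegrand_latentVector, Real.norm_eq_abs]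

lemma bochnerCov_apply (hf : Measurable f) (r s : Fin 2) :
    bochnerCov ρ f x y r s = ∫ q, fourierCoeff f (!![x, x; x, y] r s) q *
      fourierCoeff f (!![x, y; y, y] r s) q ∂(ρ.prod unif) := by
  simp only [bochnerCov, latentExpectation, integral_bochnerIntegrand hf,
    integral_fourierPair_right, Matrix.of_apply (fun r s => ∫ _, _ ∂_)]

lemma kernelCov_eq_bochnerCov {C : EuclideanSpace ℝ (Fin d) → EuclideanSpace ℝ (Fin d) → ℝ}
    (hC : ∀ w₁ w₂, C w₁ w₂ = c (w₁ - w₂)) (hρ : IsBochnerMeasure ρ c) (hf : Measurable f)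
    (hx : Integrable (feature f x) (gauss d)) (hy : Integrable (feature f y) (gauss d)) :
    kernelCov C f x y = bochnerCov ρ f x y := by
  ext r s
  obtain ⟨h₁, h₂⟩ := integrable_feature_entries hx hy r s
  simp_rw [bochnerCov_apply hf, kernelCov, Matrix.of_apply, covIntegrand_apply, hC]
  exact integral_feature_mul_cov hρ hf h₁ h₂

/-- `bochnerCov` is a Gram matrix in `L²(ρ ⊗ U[0, 2π])`, hence positive semidefinite. -/
lemma bochnerCov_posSemidef [IsFiniteMeasure ρ] (hf : Measurable f)
    (hx : Integrable (feature f x) (gauss d)) (hy : Integrable (feature f y) (gauss d)) :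
    (bochnerCov ρ f x y).PosSemidef := by
  refine Matrix.PosSemidef.of_dotProduct_mulVec_nonneg ?_ fun t => ?_
  · ext r s
    simp only [Matrix.conjTranspose_apply, star_trivial, bochnerCov_apply hf]
    fin_cases r <;> fin_cases s <;> simp
  · have hxx := integrable_fourierCoeff_mul (ρ := ρ) hf hx hx
    have hxy := integrable_fourierCoeff_mul (ρ := ρ) hf hx hy
    have hyy := integrable_fourierCoeff_mul (ρ := ρ) hf hy hy
    have e : dotProduct (star t) ((bochnerCov ρ f x y).mulVec t) =
        ∫ q, (t 0 * fourierCoeff f x q + t 1 * fourierCoeff f y q) ^ 2 ∂(ρ.prod unif) := by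
      have e' : ∀ q, (t 0 * fourierCoeff f x q + t 1 * fourierCoeff f y q) ^ 2 =
          t 0 ^ 2 * (fourierCoeff f x q * fourierCoeff f x q) +
          2 * t 0 * t 1 * (fourierCoeff f x q * fourierCoeff f y q) +
          t 1 ^ 2 * (fourierCoeff f y q * fourierCoeff f y q) := fun q => by ring
      have hsum : Integrable (fun q => t 0 ^ 2 * (fourierCoeff f x q * fourierCoeff f x q) +
          2 * t 0 * t 1 * (fourierCoeff f x q * fourierCoeff f y q)) (ρ.prod unif) :=
        (hxx.const_mul _).add (hxy.const_mul _)
      simp_rw [e']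
      rw [integral_add hsum (hyy.const_mul _),
        integral_add (hxx.const_mul _) (hxy.const_mul _), integral_const_mul, integral_const_mul,
        integral_const_mul]
      simp [dotProduct, Matrix.mulVec, Fin.sum_univ_two, bochnerCov_apply hf]
      ring
    rw [e]
    exact integral_nonneg fun q => sq_nonneg _

end

/-! ### Weighted integrals of Gaussian processes -/

section GaussianHilbertSpace

variable {T Ω : Type*} [MeasurableSpace Ω] {P : Measure Ω} {U : T → Ω → ℝ}

/-- The elements of `L²(P)` that satisfy the characteristic function identity of a centred Gaussian
variable, `E exp(iX) = exp(-‖X‖² / 2)`. -/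
def gaussianChar (P : Measure Ω) : Set (Lp ℝ 2 P) :=
  {v | ∫ ω, Complex.exp ((v ω : ℂ) * Complex.I) ∂P = Complex.exp (-(‖v‖ : ℂ) ^ 2 / 2)}

lemma integrable_exp_mul_I [IsProbabilityMeasure P] (v : Lp ℝ 2 P) :
    Integrable (fun ω => Complex.exp ((v ω : ℂ) * Complex.I)) P := by
  have hv := Lp.aestronglyMeasurable v
  refine Integrable.of_bound (C := 1) ?_ (.of_forall fun ω => ?_)
  · exact Complex.continuous_exp.comp_aestronglyMeasurable
      ((Complex.continuous_ofReal.comp_aestronglyMeasurable hv).mul_const _)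
  · rw [Complex.norm_exp_ofReal_mul_I]

lemma integral_norm_le_norm [IsProbabilityMeasure P] (v : Lp ℝ 2 P) :
    ∫ ω, ‖v ω‖ ∂P ≤ ‖v‖ := by
  have h := eLpNorm_le_eLpNorm_of_exponent_le (p := 1) (q := 2) (by norm_num)
    (Lp.aestronglyMeasurable v)
  rw [integral_norm_eq_lintegral_enorm (Lp.aestronglyMeasurable v), Lp.norm_def,
    ← eLpNorm_one_eq_lintegral_enorm]
  exact ENNReal.toReal_mono (Lp.eLpNorm_ne_top v) h

/-- Both sides of the defining identity are continuous on `L²(P)`; the left one is 1-Lipschitz, as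
`s ↦ exp(is)` is and the `L¹` norm is at most the `L²` norm. -/
lemma isClosed_gaussianChar [IsProbabilityMeasure P] : IsClosed (gaussianChar P) := by
  refine isClosed_eq ?_ (by fun_prop)
  refine (LipschitzWith.of_dist_le_mul (K := 1) fun u v => ?_).continuous
  rw [dist_eq_norm, dist_eq_norm, ← integral_sub (integrable_exp_mul_I u) (integrable_exp_mul_I v),
    NNReal.coe_one, one_mul]
  refine (norm_integral_le_integral_norm _).trans (le_trans ?_ (integral_norm_le_norm (u - v)))
  refine integral_mono_ae ((integrable_exp_mul_I u).sub (integrable_exp_mul_I v)).norm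
    ((Lp.memLp (u - v)).integrable (by norm_num)).norm ?_
  filter_upwards [Lp.coeFn_sub u v] with ω hω
  have h := Real.norm_exp_I_mul_ofReal_sub_one_le (x := u ω - v ω)
  have e : Complex.exp ((u ω : ℂ) * Complex.I) - Complex.exp ((v ω : ℂ) * Complex.I)
      = Complex.exp ((v ω : ℂ) * Complex.I) *
        (Complex.exp (Complex.I * ((u ω - v ω : ℝ) : ℂ)) - 1) := by
    rw [mul_sub, ← Complex.exp_add, mul_one]
    congr 2
    push_cast
    ring
  rw [e, norm_mul, Complex.norm_exp_ofReal_mul_I, one_mul, hω]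
  exact h

/-- The marginals of a Gaussian process as elements of `L²(P)`. -/
def marginalLp (hU : IsGaussianProcess U P) (t : T) : Lp ℝ 2 P :=
  (hU.hasGaussianLaw_eval t).memLp_two.toLp

lemma marginalLp_ae (hU : IsGaussianProcess U P) (t : T) : marginalLp hU t =ᵐ[P] U t :=
  MemLp.coeFn_toLp _

lemma inner_marginalLp (hU : IsGaussianProcess U P) (s t : T) :
    inner ℝ (marginalLp hU s) (marginalLp hU t) = ∫ ω, U s ω * U t ω ∂P := by
  rw [L2.inner_def]
  refine integral_congr_ae ?_
  filter_upwards [marginalLp_ae hU s, marginalLp_ae hU t] with ω h1 h2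
  simp [h1, h2, mul_comm]

lemma continuous_marginalLp [TopologicalSpace T] (hU : IsGaussianProcess U P)
    (hC : Continuous fun p : T × T => ∫ ω, U p.1 ω * U p.2 ω ∂P) :
    Continuous (marginalLp hU) := by
  refine continuous_iff_continuousAt.2 fun s => tendsto_iff_norm_sub_tendsto_zero.2 ?_
  have h : Continuous fun t => ‖marginalLp hU t - marginalLp hU s‖ ^ 2 := by
    simp_rw [@norm_sub_sq_real, ← real_inner_self_eq_norm_sq, inner_marginalLp]
    have h1 := hC.comp (continuous_id.prodMk continuous_id)
    have h2 := hC.comp (continuous_id.prodMk (continuous_const (y := s)))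
    simp only [Function.comp_def, id] at h1 h2
    fun_prop
  have h' := (h.sqrt).tendsto s
  simpa [Real.sqrt_sq] using h'

lemma mem_gaussianChar_of_hasGaussianLaw {v : Lp ℝ 2 P} (hv : HasGaussianLaw v P)
    (h0 : ∫ ω, v ω ∂P = 0) : v ∈ gaussianChar P := by
  have h := hv.charFun_map_eq 1
  have hvar : Var[fun ω => v ω; P] = ‖v‖ ^ 2 := by
    rw [variance_of_integral_eq_zero hv.aemeasurable h0, ← real_inner_self_eq_norm_sq, L2.inner_def]
    simp [sq]
  rw [charFun_apply, integral_map hv.aemeasurable (by fun_prop)] at h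
  simpa [h0, hvar, gaussianChar, neg_div] using h

lemma span_marginalLp_subset (hU : IsGaussianProcess U P) (h0 : ∀ t, ∫ ω, U t ω ∂P = 0) :
    (Submodule.span ℝ (Set.range (marginalLp hU)) : Set (Lp ℝ 2 P)) ⊆ gaussianChar P := by
  intro v hv
  obtain ⟨a, rfl⟩ := Finsupp.mem_span_range_iff_exists_finsupp.1 hv
  have hae : (fun ω => ∑ t ∈ a.support, a t • U t ω) =ᵐ[P]
      ((a.sum fun t r => r • marginalLp hU t : Lp ℝ 2 P) : Ω → ℝ) := by
    have h1 := Lp.coeFn_finsetSum a.support fun t => a t • marginalLp hU t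
    have h2 : ∀ᵐ ω ∂P, ∀ t ∈ a.support, (a t • marginalLp hU t : Lp ℝ 2 P) ω = a t • U t ω := by
      refine (ae_ball_iff a.support.countable_toSet).2 fun t _ => ?_
      filter_upwards [Lp.coeFn_smul (a t) (marginalLp hU t), marginalLp_ae hU t] with ω h3 h4
      rw [h3, Pi.smul_apply, h4]
    filter_upwards [h1, h2] with ω h1 h2
    rw [Finsupp.sum, h1, Finset.sum_apply]
    exact (Finset.sum_congr rfl h2).symm
  refine mem_gaussianChar_of_hasGaussianLaw (((hU.smul a).hasGaussianLaw_fun_sum).congr hae) ?_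
  rw [← integral_congr_ae hae, integral_finsetSum]
  · simp [integral_const_mul, h0]
  · exact fun t _ => ((hU.hasGaussianLaw_eval t).integrable).const_mul _

lemma closure_span_marginalLp_subset (hU : IsGaussianProcess U P) (h0 : ∀ t, ∫ ω, U t ω ∂P = 0) :
    ((Submodule.span ℝ (Set.range (marginalLp hU))).topologicalClosure : Set (Lp ℝ 2 P)) ⊆
      gaussianChar P :=
  have := hU.isProbabilityMeasure
  closure_minimal (span_marginalLp_subset hU h0) isClosed_gaussianChar

/-- The weighted integral `∫ h(t) U(t) dμ(t)`, taken as a Bochner integral with values in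
`L²(P)`. -/
def weightedLp [MeasurableSpace T] (hU : IsGaussianProcess U P) (μ : Measure T) (h : T → ℝ) :
    Lp ℝ 2 P :=
  ∫ t, h t • marginalLp hU t ∂μ

lemma integrable_mul_process [MeasurableSpace T] {μ : Measure T} [SFinite μ] {h : T → ℝ} {M : ℝ}
     (hU : IsGaussianProcess U P)
    (hmeas : Measurable fun p : T × Ω => U p.1 p.2)
    (hM : ∀ t, ∫ ω, U t ω * U t ω ∂P ≤ M) (hh : Integrable h μ) :
    Integrable (fun p : T × Ω => h p.1 * U p.1 p.2) (μ.prod P) := by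
  have := hU.isProbabilityMeasure
  have hm : AEStronglyMeasurable (fun p : T × Ω => h p.1 * U p.1 p.2) (μ.prod P) :=
    hh.aestronglyMeasurable.comp_fst.mul hmeas.aestronglyMeasurable
  refine (integrable_prod_iff hm).2 ⟨.of_forall fun t =>
    ((hU.hasGaussianLaw_eval t).integrable).const_mul (h t), ?_⟩
  refine (hh.norm.mul_const (1 + M)).mono' hm.norm.integral_prod_right' (.of_forall fun t => ?_)
  have hint : Integrable (fun ω => U t ω * U t ω) P := by
    simpa [sq] using ((hU.hasGaussianLaw_eval t).memLp_two).integrable_sq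
  -- A uniform first moment bound, from `|u| ≤ 1 + u²`.
  have hle : ∫ ω, ‖U t ω‖ ∂P ≤ 1 + M := by
    calc ∫ ω, ‖U t ω‖ ∂P ≤ ∫ ω, (1 + U t ω * U t ω) ∂P := by
          refine integral_mono (hU.hasGaussianLaw_eval t).integrable.norm
            ((integrable_const _).add hint) fun ω => ?_
          dsimp only
          rw [Real.norm_eq_abs, ← abs_mul_abs_self (U t ω)]
          nlinarith [sq_nonneg (|U t ω| - 1), abs_nonneg (U t ω)]
      _ = 1 + ∫ ω, U t ω * U t ω ∂P := by
          rw [integral_add (integrable_const _) hint]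
          simp
      _ ≤ 1 + M := by linarith [hM t]
  simp only [norm_mul, integral_const_mul]
  rw [norm_norm, Real.norm_of_nonneg (integral_nonneg fun _ => norm_nonneg _)]
  exact mul_le_mul_of_nonneg_left hle (norm_nonneg _)

section WeightedIntegral

variable [MeasurableSpace T] [TopologicalSpace T] [BorelSpace T] [SecondCountableTopology T]
  {μ : Measure T} {h k : T → ℝ} {M : ℝ}

lemma integrable_smul_marginalLp (hU : IsGaussianProcess U P)
    (hC : Continuous fun p : T × T => ∫ ω, U p.1 ω * U p.2 ω ∂P)
    (hM : ∀ t, ∫ ω, U t ω * U t ω ∂P ≤ M) (hh : Integrable h μ) :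
    Integrable (fun t => h t • marginalLp hU t) μ := by
  refine hh.smul_bdd (√M) (continuous_marginalLp hU hC).aestronglyMeasurable
    (.of_forall fun t => Real.le_sqrt_of_sq_le ?_)
  rw [← real_inner_self_eq_norm_sq, inner_marginalLp]
  exact hM t

lemma inner_weightedLp (hU : IsGaussianProcess U P)
    (hC : Continuous fun p : T × T => ∫ ω, U p.1 ω * U p.2 ω ∂P)
    (hM : ∀ t, ∫ ω, U t ω * U t ω ∂P ≤ M) (hh : Integrable h μ) (hk : Integrable k μ) :
    inner ℝ (weightedLp hU μ h) (weightedLp hU μ k) =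
      ∫ s, ∫ t, h s * (∫ ω, U s ω * U t ω ∂P) * k t ∂μ ∂μ := by
  rw [weightedLp, weightedLp, real_inner_comm,
    ← integral_inner (integrable_smul_marginalLp hU hC hM hh)]
  refine integral_congr_ae (.of_forall fun s => ?_)
  dsimp only
  rw [real_inner_comm, ← integral_inner (integrable_smul_marginalLp hU hC hM hk)]
  refine integral_congr_ae (.of_forall fun t => ?_)
  simp only [real_inner_smul_left, real_inner_smul_right, inner_marginalLp]
  ring

/-- A Bochner integral lies in the closed span of the values of the integrand, because it is
orthogonal to whatever is orthogonal to these values. -/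
lemma weightedLp_mem_closure_span (hU : IsGaussianProcess U P)
    (hC : Continuous fun p : T × T => ∫ ω, U p.1 ω * U p.2 ω ∂P)
    (hM : ∀ t, ∫ ω, U t ω * U t ω ∂P ≤ M) (hh : Integrable h μ) :
    weightedLp hU μ h ∈
      (Submodule.span ℝ (Set.range (marginalLp hU))).topologicalClosure := by
  rw [← Submodule.orthogonal_orthogonal_eq_closure, Submodule.mem_orthogonal]
  intro v hv
  rw [weightedLp, ← integral_inner (integrable_smul_marginalLp hU hC hM hh)]
  refine integral_eq_zero_of_ae (.of_forall fun t => ?_)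
  have := (Submodule.mem_orthogonal' _ _).1 hv (marginalLp hU t)
    (Submodule.subset_span (Set.mem_range_self t))
  simp [real_inner_smul_right, this]

/-- The Bochner integral in `L²(P)` and the pathwise integral agree almost surely: they have the
same integral over every event. -/
lemma weightedLp_ae [SFinite μ] (hU : IsGaussianProcess U P)
    (hmeas : Measurable fun p : T × Ω => U p.1 p.2)
    (hC : Continuous fun p : T × T => ∫ ω, U p.1 ω * U p.2 ω ∂P)
    (hM : ∀ t, ∫ ω, U t ω * U t ω ∂P ≤ M) (hh : Integrable h μ) :
    weightedLp hU μ h =ᵐ[P] fun ω => ∫ t, h t * U t ω ∂μ := by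
  have := hU.isProbabilityMeasure
  have hint := integrable_mul_process hU hmeas hM hh
  refine Integrable.ae_eq_of_forall_setIntegral_eq _ _
    ((Lp.memLp _).integrable (by norm_num)) hint.integral_prod_right fun s hs _ => ?_
  have hint' : Integrable (fun p : T × Ω => h p.1 * U p.1 p.2) (μ.prod (P.restrict s)) := by
    have := hint.restrict (s := Set.univ ×ˢ s)
    rwa [← Measure.prod_restrict, Measure.restrict_univ] at this
  rw [← L2.inner_indicatorConstLp_one (𝕜 := ℝ) hs (measure_ne_top P s), weightedLp,
    ← integral_inner (integrable_smul_marginalLp hU hC hM hh),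
    ← integral_integral_swap (f := fun t ω => h t * U t ω) hint']
  refine integral_congr_ae (.of_forall fun t => ?_)
  dsimp only
  rw [real_inner_smul_right, L2.inner_indicatorConstLp_one, integral_const_mul,
    integral_congr_ae (ae_restrict_of_ae (marginalLp_ae hU t))]

end WeightedIntegral

end GaussianHilbertSpace

/-! ### The law of the second layer inputs -/

/-- The two second layer inputs converge absolutely almost surely and are jointly centred Gaussian
with covariance `bochnerCov`. -/
lemma hasLaw_response {d : ℕ} {f : ℝ → ℝ} (hf : Measurable f)
    {C : EuclideanSpace ℝ (Fin d) → EuclideanSpace ℝ (Fin d) → ℝ}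
    {c : EuclideanSpace ℝ (Fin d) → ℝ} (hC : ∀ w₁ w₂, C w₁ w₂ = c (w₁ - w₂))
    {ρ : Measure (EuclideanSpace ℝ (Fin d))} (hρ : IsBochnerMeasure ρ c)
    {x y : EuclideanSpace ℝ (Fin d)} (hx : Integrable (feature f x) (gauss d))
    (hy : Integrable (feature f y) (gauss d)) {Ω : Type*} [MeasurableSpace Ω] {P : Measure Ω}
    [IsProbabilityMeasure P] {U : EuclideanSpace ℝ (Fin d) → Ω → ℝ} (hU : IsGP C U P) :
    (∀ᵐ ω ∂P, Integrable (fun w => feature f x w * U w ω) (gauss d)) ∧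
    (∀ᵐ ω ∂P, Integrable (fun w => feature f y w * U w ω) (gauss d)) ∧
    HasLaw (fun ω => !₂[response f x fun w => U w ω, response f y fun w => U w ω])
      (multivariateGaussian 0 (bochnerCov ρ f x y)) P := by
  have := hρ.1
  have hcov : ∀ w₁ w₂, ∫ ω, U w₁ ω * U w₂ ω ∂P = c (w₁ - w₂) := fun w₁ w₂ => by
    rw [hU.covariance, hC]
  have hcont : Continuous fun p : EuclideanSpace ℝ (Fin d) × EuclideanSpace ℝ (Fin d) =>
      ∫ ω, U p.1 ω * U p.2 ω ∂P := by
    simp_rw [hcov]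
    exact hρ.continuous.comp (continuous_fst.sub continuous_snd)
  have hM : ∀ w, ∫ ω, U w ω * U w ω ∂P ≤ c 0 := fun w => by rw [hcov, sub_self]
  have hjoint : ∀ p, Integrable (feature f p) (gauss d) →
      Integrable (fun a : EuclideanSpace ℝ (Fin d) × Ω => feature f p a.1 * U a.1 a.2)
        ((gauss d).prod P) := fun p hp => integrable_mul_process hU.gaussian hU.measurable hM hp
  refine ⟨(hjoint x hx).prod_left_ae, (hjoint y hy).prod_left_ae, ?_⟩
  have hresp : ∀ p, AEMeasurable (fun ω => response f p fun w => U w ω) P := fun p => by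
    have hm : StronglyMeasurable (fun a : Ω × EuclideanSpace ℝ (Fin d) =>
        feature f p a.2 * U a.2 a.1) :=
      (((measurable_feature hf p).comp measurable_snd).mul
        (hU.measurable.comp measurable_swap)).stronglyMeasurable
    exact hm.integral_prod_right'.measurable.aemeasurable
  have hpair : AEMeasurable
      (fun ω => !₂[response f x fun w => U w ω, response f y fun w => U w ω]) P := by
    refine (PiLp.continuous_toLp 2 _).measurable.comp_aemeasurable
      (aemeasurable_pi_iff.2 fun i => ?_)
    fin_cases i
    · exact hresp x
    · exact hresp y
  refine ⟨hpair, ?_⟩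
  have := Measure.isProbabilityMeasure_map hpair
  refine Measure.ext_of_charFun (funext fun t => ?_)
  rw [charFun_multivariateGaussian (bochnerCov_posSemidef hf hx hy), charFun_apply,
    integral_map hpair (by fun_prop)]
  set X := weightedLp hU.gaussian (gauss d) (feature f x) with hX
  set Y := weightedLp hU.gaussian (gauss d) (feature f y) with hY
  have hinner : ∀ p q, Integrable (feature f p) (gauss d) → Integrable (feature f q) (gauss d) →
      inner ℝ (weightedLp hU.gaussian (gauss d) (feature f p))
        (weightedLp hU.gaussian (gauss d) (feature f q)) =
      ∫ a, fourierCoeff f p a * fourierCoeff f q a ∂(ρ.prod unif) := fun p q hp hq => by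
    rw [inner_weightedLp hU.gaussian hcont hM hp hq, ← integral_feature_mul_cov hρ hf hp hq,
      integral_prod _ (integrable_feature_mul_cov hρ hf hp hq)]
    simp_rw [hcov]
  -- The variable `t 0 X + t 1 Y` is Gaussian; its variance is the quadratic form of
  -- `bochnerCov`.
  have hmem : t 0 • X + t 1 • Y ∈ gaussianChar P := by
    refine closure_span_marginalLp_subset hU.gaussian hU.mean_zero ?_
    exact Submodule.add_mem _
      (Submodule.smul_mem _ _ (weightedLp_mem_closure_span hU.gaussian hcont hM hx))
      (Submodule.smul_mem _ _ (weightedLp_mem_closure_span hU.gaussian hcont hM hy))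
  have hnorm : ‖t 0 • X + t 1 • Y‖ ^ 2 =
      dotProduct (t : Fin 2 → ℝ) ((bochnerCov ρ f x y).mulVec t) := by
    rw [norm_add_sq_real, norm_smul, norm_smul, mul_pow, mul_pow, Real.norm_eq_abs,
      Real.norm_eq_abs, sq_abs, sq_abs, real_inner_smul_left, real_inner_smul_right,
      ← real_inner_self_eq_norm_sq X, ← real_inner_self_eq_norm_sq Y, hX, hY, hinner x x hx hx,
      hinner x y hx hy, hinner y y hy hy]
    simp [dotProduct, Matrix.mulVec, Fin.sum_univ_two, bochnerCov_apply hf]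
    ring
  have hmem' : ∫ ω, Complex.exp (((t 0 • X + t 1 • Y : Lp ℝ 2 P) ω : ℂ) * Complex.I) ∂P =
    Complex.exp (-(‖t 0 • X + t 1 • Y‖ : ℂ) ^ 2 / 2) := hmem
  rw [inner_zero_right, Complex.ofReal_zero, zero_mul, zero_sub, ← hnorm, Complex.ofReal_pow,
    ← neg_div, ← hmem']
  refine integral_congr_ae ?_
  filter_upwards [Lp.coeFn_add (t 0 • X) (t 1 • Y), Lp.coeFn_smul (t 0) X, Lp.coeFn_smul (t 1) Y,
    weightedLp_ae hU.gaussian hU.measurable hcont hM hx,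
    weightedLp_ae hU.gaussian hU.measurable hcont hM hy] with ω h1 h2 h3 h4 h5
  rw [h1, Pi.add_apply, h2, h3, Pi.smul_apply, Pi.smul_apply, h4, h5, PiLp.inner_apply,
    Fin.sum_univ_two]
  simp [response]

end DeepInfinite

end

theorem corollary1 {d : ℕ} (f : ℝ → ℝ) (hf : Measurable f)
    (C : EuclideanSpace ℝ (Fin d) → EuclideanSpace ℝ (Fin d) → ℝ)
    (c : EuclideanSpace ℝ (Fin d) → ℝ) (hC : ∀ w₁ w₂, C w₁ w₂ = c (w₁ - w₂))
    (ρ : Measure (EuclideanSpace ℝ (Fin d))) (hρ : DeepInfinite.IsBochnerMeasure ρ c)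
    (x y : EuclideanSpace ℝ (Fin d))
    (hx : Integrable (DeepInfinite.feature f x) (DeepInfinite.gauss d))
    (hy : Integrable (DeepInfinite.feature f y) (DeepInfinite.gauss d)) :
    -- the covariance matrix of `ẑ` is a covariance matrix, and all expectations exist
    (∀ w, (DeepInfinite.latentCov x y w).PosSemidef) ∧
    (∀ r s, DeepInfinite.LatentIntegrable ρ x y
      fun b z => DeepInfinite.bochnerIntegrand f b z r s) ∧
    (∀ r s, Integrable (fun p => DeepInfinite.covIntegrand C f x y p.1 p.2 r s)
      ((DeepInfinite.gauss d).prod (DeepInfinite.gauss d))) ∧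
    -- the covariance matrix of the stochastic kernel is the expectation over `w`, `b`, `ẑ`
    DeepInfinite.kernelCov C f x y = DeepInfinite.bochnerCov ρ f x y ∧
    (DeepInfinite.bochnerCov ρ f x y).PosSemidef ∧
    -- and the stochastic kernel of `GP(C)` is the Gaussian expectation with this covariance
    ∀ (Ω : Type u) [MeasurableSpace Ω] (P : Measure Ω) [IsProbabilityMeasure P]
      (U : EuclideanSpace ℝ (Fin d) → Ω → ℝ), DeepInfinite.IsGP C U P →
      (∀ᵐ ω ∂P, Integrable (fun w => DeepInfinite.feature f x w * U w ω)
          (DeepInfinite.gauss d)) ∧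
      (∀ᵐ ω ∂P, Integrable (fun w => DeepInfinite.feature f y w * U w ω)
          (DeepInfinite.gauss d)) ∧
      HasLaw (fun ω => !₂[DeepInfinite.response f x fun w => U w ω,
          DeepInfinite.response f y fun w => U w ω])
        (multivariateGaussian 0 (DeepInfinite.bochnerCov ρ f x y)) P ∧
      (Integrable (fun ω => f (DeepInfinite.response f x fun w => U w ω) *
          f (DeepInfinite.response f y fun w => U w ω)) P ↔
        Integrable (fun z : EuclideanSpace ℝ (Fin 2) => f (z 0) * f (z 1))
          (multivariateGaussian 0 (DeepInfinite.bochnerCov ρ f x y))) ∧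
      DeepInfinite.stochasticKernel f U P x y =
        ∫ z : EuclideanSpace ℝ (Fin 2), f (z 0) * f (z 1)
          ∂(multivariateGaussian 0 (DeepInfinite.bochnerCov ρ f x y)) := by
  have := hρ.1
  refine ⟨DeepInfinite.latentCov_posSemidef x y,
    DeepInfinite.latentIntegrable_bochnerIntegrand hf hx hy, fun r s => ?_,
    DeepInfinite.kernelCov_eq_bochnerCov hC hρ hf hx hy,
    DeepInfinite.bochnerCov_posSemidef hf hx hy, fun Ω _ P _ U hU => ?_⟩
  · obtain ⟨h₁, h₂⟩ := DeepInfinite.integrable_feature_entries hx hy r s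
    simp_rw [DeepInfinite.covIntegrand_apply, hC]
    exact DeepInfinite.integrable_feature_mul_cov hρ hf h₁ h₂
  · obtain ⟨hix, hiy, hlaw⟩ := DeepInfinite.hasLaw_response hf hC hρ hx hy hU
    have hF : Measurable fun z : EuclideanSpace ℝ (Fin 2) => f (z 0) * f (z 1) := by fun_prop
    refine ⟨hix, hiy, hlaw, ?_, ?_⟩
    · rw [← hlaw.map_eq, integrable_map_measure hF.aestronglyMeasurable hlaw.aemeasurable]
      rfl
    · exact hlaw.integral_comp hF.aestronglyMeasurable
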